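/- Let $0<\alpha<1$ and $b<X$, and let $y\in C^4[b,X]$ be real-valued with $y(b)=y'(b)=y''(b)=0$ (one-sided derivatives at $b$). For $x\in[b,X]$ let $$y^{(\alpha)}(x)=\frac{1}{\Gamma(1-\alpha)}\int_b^x\frac{y'(\xi)}{(x-\xi)^\alpha}\,d\xi$$ be the Caputo derivative of order $\alpha$ with lower limit $b$, and for $h>0$ let $$\Delta_h^\alpha y(x)=\sum_{n=0}^{\lfloor (x-b)/h\rfloor}(-1)^n\binom{\alpha}{n}\,y(x-nh),\qquad \binom{\alpha}{n}=\frac{\alpha(\alpha-1)\cdots(\alpha-n+1)}{n!},$$ be the (unshifted) Grünwald difference operator. Then $$h^{-\alpha}\Delta_h^\alpha y(x)=y^{(\alpha)}\left(x-\frac{\alpha h}{2}\right)+O(h^2),$$ uniformly in $x$: there is a constant $C$, depending only on $\alpha,b,X,y$, such that $$\left|h^{-\alpha}\Delta_h^\alpha y(x)-y^{(\alpha)}\left(x-\frac{\alpha h}{2}\right)\right|\le C h^2$$ for all $x\in(b,X]$ and all $h>0$ with $x-\alpha h/2\ge b$. In particular, for $x=X$ fixed the formula holds as $h\to0^+$.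 -/

import Mathlib

open Set

noncomputable section

/-- The Caputo fractional derivative of order `α` (meant for `0 < α < 1`) with lower limit `b`,
`(1 / Γ(1 - α)) ∫_b^x y'(ξ) / (x - ξ)^α dξ`. For `y` of class `C^1` on `[b, X]` and `b ≤ x ≤ X`
the two-sided derivative agrees with the derivative relative to `[b, X]` on the open interval
`(b, x)`, so the value depends only on `y` restricted to `[b, x]`. -/
def caputoDeriv (α b : ℝ) (y : ℝ → ℝ) (x : ℝ) : ℝ :=
  1 / Real.Gamma (1 - α) * ∫ ξ in b..x, deriv y ξ / (x - ξ) ^ α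

/-- The Grünwald weights `w_n = (-1)^n * binom(α, n)`, where
`binom(α, n) = α (α - 1) ⋯ (α - n + 1) / n!`. -/
def grunwaldWeight (α : ℝ) (n : ℕ) : ℝ :=
  (-1) ^ n * Ring.choose α n

/-- The (unshifted) Grünwald difference operator with lower limit `b` and step `h`:
the sum of `w_n * y (x - n h)` over `0 ≤ n ≤ ⌊(x - b) / h⌋`. -/
def grunwaldDiff (α b h : ℝ) (y : ℝ → ℝ) (x : ℝ) : ℝ :=
  ∑ n ∈ Finset.range (⌊(x - b) / h⌋₊ + 1), grunwaldWeight α n * y (x - n * h)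

end

/-! Peano kernel argument. Since `y`, `y'`, `y''` vanish at `b`, both `y` and its Caputo derivative
are integrals of `y'''` against truncated powers of `x - s`. Hence the error is `∫ y'''(s) h^(2-α)
k((x-s)/h) ds` with `k = grunwaldKernel α` (`grunwald_sub_caputoDeriv_eq_integral`). If `|k(t)| ≤ C
t^(-α)` (`exists_abs_grunwaldKernel_le`), the powers of `h` combine to `h^2`, and the remaining
weight `(x-s)^(-α)` is integrable because `α < 1`.

For the kernel bound, put `β = 2 - α`, `m = ⌊t⌋`, `φ = t - m - 1`, `p = m + β/2`, so that `t - α/2 =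
p + φ`. The weighted sum has a closed form in coefficients of powers of `1 - z`
(`sum_grunwaldWeight_mul_sq`). Centring at `p` removes the first correction in the Gamma ratio:
`Γ(m+β)/m! = p^(β-1) (1 + O(m^(-2)))` (`abs_logGammaRatio_le`). The sum then agrees with `(p + φ)^β`
to first order in `φ/p`, and the remainder is `O(p^(β-2)) = O(t^(-α))`. This is where the shift `α
h/2` is needed. -/

noncomputable section

/-! ### Rising factorial coefficients and sums of Grünwald weights -/

/-- The coefficient `c (c + 1) ⋯ (c + m - 1) / m!` of `z ^ m` in `(1 - z) ^ (-c)`. -/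
def risingCoeff (c : ℝ) (m : ℕ) : ℝ :=
  ∏ k ∈ Finset.range m, (c + k) / (k + 1)

@[simp]
lemma risingCoeff_zero (c : ℝ) : risingCoeff c 0 = 1 := by
  simp [risingCoeff]

lemma risingCoeff_succ (c : ℝ) (m : ℕ) :
    risingCoeff c (m + 1) = risingCoeff c m * ((c + m) / (m + 1)) :=
  Finset.prod_range_succ _ _

lemma risingCoeff_pos {c : ℝ} (hc : 0 < c) (m : ℕ) : 0 < risingCoeff c m :=
  Finset.prod_pos fun k _ => by positivity

lemma mul_risingCoeff_add_one (c : ℝ) (m : ℕ) :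
    c * risingCoeff (c + 1) m = (c + m) * risingCoeff c m := by
  induction m with
  | zero => simp
  | succ m ih =>
    have hm : (m : ℝ) + 1 ≠ 0 := by positivity
    rw [risingCoeff_succ, risingCoeff_succ, ← mul_assoc, ih]
    push_cast
    field_simp
    ring

/-- Compare coefficients in `(1 - z) (1 - z)^(-(c+1)) = (1 - z)^(-c)`. -/
lemma risingCoeff_add_one_succ (c : ℝ) (m : ℕ) :
    risingCoeff (c + 1) (m + 1) = risingCoeff (c + 1) m + risingCoeff c (m + 1) := by
  have hm : (m : ℝ) + 1 ≠ 0 := by positivity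
  rw [risingCoeff_succ, risingCoeff_succ]
  have := mul_risingCoeff_add_one c m
  field_simp
  linear_combination this

lemma grunwaldWeight_eq_risingCoeff (α : ℝ) (n : ℕ) :
    grunwaldWeight α n = risingCoeff (-α) n := by
  induction n with
  | zero => simp [grunwaldWeight]
  | succ n ih =>
    have hn : (n : ℝ) + 1 ≠ 0 := by positivity
    have hf : (n.factorial : ℝ) ≠ 0 := by positivity
    rw [risingCoeff_succ, ← ih, grunwaldWeight, grunwaldWeight, Ring.choose_eq_smul,
      Ring.choose_eq_smul, descPochhammer_succ_right, Polynomial.smeval_mul, Nat.factorial_succ]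
    simp only [Polynomial.smeval_sub, Polynomial.smeval_X, Polynomial.smeval_natCast, pow_one,
      pow_zero, smul_eq_mul, nsmul_eq_mul, mul_one]
    push_cast
    field_simp
    ring

/-- The Grünwald weights applied to `t ↦ t ^ 2 / 2`. -/
lemma sum_grunwaldWeight_mul_sq (α : ℝ) (m : ℕ) (θ : ℝ) :
    ∑ n ∈ Finset.range (m + 1), grunwaldWeight α n * ((m + θ - n) ^ 2 / 2) =
      risingCoeff (3 - α) m + (θ - 3 / 2) * risingCoeff (2 - α) m +
        (1 - θ) ^ 2 / 2 * risingCoeff (1 - α) m := by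
  induction m generalizing θ with
  | zero =>
    simp [grunwaldWeight]
    ring
  | succ m ih =>
    rw [Finset.sum_range_succ]
    -- `(m + 1) + θ = m + (θ + 1)`: raising `m` shifts `θ` by one and adds a single new term, so `θ`
    -- must stay free in the induction.
    have h := ih (θ + 1)
    have e : ∀ n : ℕ, ((m + 1 : ℕ) : ℝ) + θ - n = m + (θ + 1) - n := fun n => by
      push_cast; ring
    simp only [e, h]
    rw [grunwaldWeight_eq_risingCoeff]
    have h1 := risingCoeff_add_one_succ (2 - α) m
    have h2 := risingCoeff_add_one_succ (1 - α) m
    have h3 := risingCoeff_add_one_succ (-α) m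
    rw [show 2 - α + 1 = 3 - α by ring] at h1
    rw [show 1 - α + 1 = 2 - α by ring] at h2
    rw [show -α + 1 = 1 - α by ring] at h3
    push_cast
    rw [h1, h2, h3]
    ring

/-! ### Asymptotics of the Gamma ratio -/

lemma abs_log_one_add_sub_log_one_sub_le {x : ℝ} (hx0 : 0 ≤ x) (hx : x ≤ 1 / 2) :
    |Real.log (1 + x) - Real.log (1 - x) - 2 * x| ≤ 4 * x ^ 3 := by
  have h1 := Real.abs_log_sub_add_sum_range_le (x := x) (by rw [abs_of_nonneg hx0]; linarith) 2
  have h2 := Real.abs_log_sub_add_sum_range_le (x := -x)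
    (by rw [abs_neg, abs_of_nonneg hx0]; linarith) 2
  simp only [Finset.sum_range_succ, Finset.sum_range_zero, abs_neg, abs_of_nonneg hx0] at h1 h2
  have h3 : x ^ (2 + 1) / (1 - x) ≤ 2 * x ^ 3 := by
    rw [div_le_iff₀ (by linarith)]
    change x ^ 3 ≤ _
    nlinarith [mul_nonneg (pow_nonneg hx0 3) (by linarith : 0 ≤ 1 - 2 * x)]
  rw [sub_neg_eq_add] at h2
  have h1' := abs_le.1 (h1.trans h3)
  have h2' := abs_le.1 (h2.trans h3)
  norm_num at h1' h2'
  rw [abs_le]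
  constructor <;> linarith [h1'.1, h1'.2, h2'.1, h2'.2]

lemma log_add_sub_log_sub {s δ : ℝ} (hδ : 0 ≤ δ) (hs : 2 * δ ≤ s) (hs0 : 0 < s) :
    |Real.log (s + δ) - Real.log (s - δ) - 2 * (δ / s)| ≤ 4 * (δ / s) ^ 3 := by
  have hx : δ / s ≤ 1 / 2 := by
    rw [div_le_iff₀ hs0]; linarith
  have h := abs_log_one_add_sub_log_one_sub_le (div_nonneg hδ hs0.le) hx
  have h1 : s + δ = s * (1 + δ / s) := by field_simp
  have h2 : s - δ = s * (1 - δ / s) := by field_simp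
  have h3 : 0 ≤ δ / s := div_nonneg hδ hs0.le
  rw [h1, h2, Real.log_mul hs0.ne' (by linarith), Real.log_mul hs0.ne' (by linarith)]
  convert! h using 2
  ring

/-- The logarithm of `Γ(m + β) / (m! (m + β / 2) ^ (β - 1))`. -/
def logGammaRatio (β : ℝ) (m : ℕ) : ℝ :=
  Real.log (Real.Gamma β * risingCoeff β m / (m + β / 2) ^ (β - 1))

lemma logGammaRatio_eq {β : ℝ} (hβ : 0 < β) (m : ℕ) :
    logGammaRatio β m = Real.log (Real.Gamma β) + Real.log (risingCoeff β m) -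
      (β - 1) * Real.log (m + β / 2) := by
  have h : 0 < (m : ℝ) + β / 2 := by positivity
  rw [logGammaRatio, Real.log_div (mul_pos (Real.Gamma_pos_of_pos hβ) (risingCoeff_pos hβ m)).ne'
    (by positivity), Real.log_mul (Real.Gamma_pos_of_pos hβ).ne' (risingCoeff_pos hβ m).ne',
    Real.log_rpow h]

/-- The shift `β / 2` gives both logarithmic quotients in the increment the same centre `s`: they
are `(s + δ)/(s - δ)` and `(s + 1/2)/(s - 1/2)`, the latter with weight `2δ`. Their leading terms
`2δ/s` cancel, leaving cubic errors. -/
lemma abs_logGammaRatio_succ_sub_le {β : ℝ} (h1 : 1 < β) (h2 : β < 2) (m : ℕ) :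
    |logGammaRatio β (m + 1) - logGammaRatio β m| ≤ 1 / ((m : ℝ) + 1) ^ 3 := by
  have hβ : 0 < β := by linarith
  have hm : (0 : ℝ) ≤ m := m.cast_nonneg
  set s : ℝ := m + (1 + β) / 2 with hs
  set δ : ℝ := (β - 1) / 2 with hδ
  have hs1 : (m : ℝ) + 1 ≤ s := by simp only [hs]; linarith
  have hs0 : 0 < s := by linarith
  have e1 := log_add_sub_log_sub (s := s) (δ := δ) (by simp only [hδ]; linarith)
    (by simp only [hδ, hs]; linarith) hs0
  have e2 := log_add_sub_log_sub (s := s) (δ := 1 / 2) (by norm_num)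
    (by simp only [hs]; linarith) hs0
  have key : logGammaRatio β (m + 1) - logGammaRatio β m =
      (Real.log (s + δ) - Real.log (s - δ) - 2 * (δ / s)) -
        2 * δ * (Real.log (s + 1 / 2) - Real.log (s - 1 / 2) - 2 * (1 / 2 / s)) := by
    rw [logGammaRatio_eq hβ, logGammaRatio_eq hβ, risingCoeff_succ,
      Real.log_mul (risingCoeff_pos hβ m).ne' (by positivity),
      Real.log_div (by positivity) (by positivity),
      show s + δ = β + m by simp only [hs, hδ]; ring,
      show s - δ = m + 1 by simp only [hs, hδ]; ring,
      show s + 1 / 2 = ((m + 1 : ℕ) : ℝ) + β / 2 by simp only [hs]; push_cast; ring,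
      show s - 1 / 2 = m + β / 2 by simp only [hs]; ring]
    simp only [hδ]
    field_simp
    ring
  rw [key]
  have hδ0 : 0 ≤ δ := by simp only [hδ]; linarith
  have hδ1 : δ ≤ 1 / 2 := by simp only [hδ]; linarith
  calc _ ≤ 4 * (δ / s) ^ 3 + 2 * δ * (4 * (1 / 2 / s) ^ 3) := by
        refine (abs_sub _ _).trans (add_le_add e1 ?_)
        rw [abs_mul, abs_of_nonneg (by positivity : 0 ≤ 2 * δ)]
        gcongr
    _ ≤ 4 * (1 / 2 / s) ^ 3 + 2 * (1 / 2) * (4 * (1 / 2 / s) ^ 3) := by gcongr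
    _ = 1 / s ^ 3 := by field_simp; norm_num
    _ ≤ _ := by gcongr

open Filter Topology in
-- This is Gauss's product formula for `Γ`, up to factors tending to `1`.
lemma tendsto_logGammaRatio {β : ℝ} (hβ : 0 < β) :
    Tendsto (logGammaRatio β) atTop (𝓝 0) := by
  have hΓ := (Real.Gamma_pos_of_pos hβ).ne'
  have hdiv : ∀ a : ℝ, 0 < a → Tendsto (fun n : ℕ => (n : ℝ) / (n + a)) atTop (𝓝 1) := by
    intro a _
    exact tendsto_natCast_div_add_atTop a
  have h1 : Tendsto (fun n : ℕ => Real.Gamma β / Real.GammaSeq β n * ((n : ℝ) / (n + β)) *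
      ((n : ℝ) / (n + β / 2)) ^ (β - 1)) atTop (𝓝 1) := by
    have hA := (tendsto_const_nhds (x := Real.Gamma β) (f := atTop (α := ℕ))).div
      (Real.GammaSeq_tendsto_Gamma β) hΓ
    have hB := (hdiv (β / 2) (by positivity)).rpow_const (p := β - 1) (Or.inl one_ne_zero)
    have := (hA.mul (hdiv β hβ)).mul hB
    simpa [div_self hΓ] using this
  have h2 : Tendsto (fun n : ℕ => Real.Gamma β * risingCoeff β n / (n + β / 2) ^ (β - 1))
      atTop (𝓝 1) := by
    refine h1.congr' ?_
    filter_upwards [eventually_gt_atTop 0] with n hn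
    have hn' : (0 : ℝ) < n := by exact_mod_cast hn
    have hr : risingCoeff β n = (∏ k ∈ Finset.range n, (β + k)) / n.factorial := by
      rw [risingCoeff, Finset.prod_div_distrib, ← Finset.prod_range_add_one_eq_factorial]
      push_cast
      rfl
    have hP : 0 < ∏ k ∈ Finset.range n, (β + (k : ℝ)) :=
      Finset.prod_pos fun k _ => by positivity
    have hf : (0 : ℝ) < n.factorial := by positivity
    rw [hr, Real.GammaSeq, Finset.prod_range_succ, Real.div_rpow hn'.le (by positivity),
      Real.rpow_sub_one hn'.ne']
    have : 0 < (n : ℝ) ^ β := by positivity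
    have : 0 < ((n : ℝ) + β / 2) ^ (β - 1) := by positivity
    field_simp
    ring
  have := h2.log one_ne_zero
  rw [Real.log_one] at this
  exact this

open Filter Topology in
-- The increments are dominated by those of `2 / (n + 1)^2`, so adding or subtracting that sequence
-- gives monotone sequences with limit `0`.
lemma abs_logGammaRatio_le {β : ℝ} (h1 : 1 < β) (h2 : β < 2) (m : ℕ) :
    |logGammaRatio β m| ≤ 2 / ((m : ℝ) + 1) ^ 2 := by
  have h0 : Tendsto (fun n : ℕ => 2 / ((n : ℝ) + 1) ^ 2) atTop (𝓝 0) := by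
    have := (tendsto_one_div_add_atTop_nhds_zero_nat (𝕜 := ℝ)).pow 2
    have := this.const_mul 2
    simpa [div_eq_mul_inv] using this
  have hstep : ∀ k : ℕ, 1 / ((k : ℝ) + 1) ^ 3 ≤
      2 / ((k : ℝ) + 1) ^ 2 - 2 / (((k + 1 : ℕ) : ℝ) + 1) ^ 2 := by
    intro k
    have hk : (0 : ℝ) ≤ k := k.cast_nonneg
    push_cast
    rw [div_sub_div _ _ (by positivity) (by positivity), div_le_div_iff₀ (by positivity)
      (by positivity)]
    have : 0 ≤ ((k : ℝ) + 1) ^ 2 * (3 * k ^ 2 + 6 * k + 2) := by positivity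
    nlinarith
  have hu := tendsto_logGammaRatio (β := β) (by linarith)
  have hs := fun k => abs_le.1 (abs_logGammaRatio_succ_sub_le h1 h2 k)
  have hA : Antitone fun n : ℕ => logGammaRatio β n + 2 / ((n : ℝ) + 1) ^ 2 :=
    antitone_nat_of_succ_le fun k => by linarith [(hs k).2, hstep k]
  have hB : Monotone fun n : ℕ => logGammaRatio β n - 2 / ((n : ℝ) + 1) ^ 2 :=
    monotone_nat_of_le_succ fun k => by linarith [(hs k).1, hstep k]
  have hA0 := hA.le_of_tendsto (hu.add h0) m
  have hB0 := hB.ge_of_tendsto (hu.sub h0) m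
  rw [abs_le]
  constructor <;> linarith

lemma risingCoeff_eq_exp_logGammaRatio {β : ℝ} (hβ : 0 < β) (m : ℕ) :
    Real.Gamma β * risingCoeff β m = (m + β / 2) ^ (β - 1) * Real.exp (logGammaRatio β m) := by
  have h : 0 < (m : ℝ) + β / 2 := by positivity
  have hΓ := Real.Gamma_pos_of_pos hβ
  have hr := risingCoeff_pos hβ m
  have hp : 0 < ((m : ℝ) + β / 2) ^ (β - 1) := by positivity
  rw [logGammaRatio, Real.exp_log (by positivity)]
  field_simp

/-! ### Decay of the Peano kernel -/

/-- Bernoulli's inequality for exponent `β` gives one side; the other is the concave Bernoulli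
inequality for `β - 1`, multiplied by `1 + q`. -/
lemma abs_one_add_rpow_sub_le {q β : ℝ} (hq : -1 ≤ q) (h1 : 1 ≤ β) (h2 : β ≤ 2) :
    |1 + β * q - (1 + q) ^ β| ≤ q ^ 2 := by
  have hlow := one_add_mul_self_le_rpow_one_add hq h1
  have hup := rpow_one_add_le_one_add_mul_self hq (p := β - 1) (by linarith) (by linarith)
  have hq' : 0 ≤ 1 + q := by linarith
  have hsplit : (1 + q) ^ β = (1 + q) ^ (β - 1) * (1 + q) := by
    conv_rhs => rw [← Real.rpow_one (1 + q), ← Real.rpow_mul hq', one_mul,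
      ← Real.rpow_add_of_nonneg hq' (by linarith) zero_le_one]
    ring_nf
  have := mul_le_mul_of_nonneg_right hup hq'
  rw [abs_le]
  constructor <;> nlinarith [sq_nonneg q]

lemma abs_exp_sub_one_le_of_abs_le {u c : ℝ} (hu : |u| ≤ c) :
    |Real.exp u - 1| ≤ |u| * Real.exp c := by
  have hc : 0 ≤ c := (abs_nonneg u).trans hu
  have h1 := Real.add_one_le_exp u
  have h2 := Real.add_one_le_exp (-u)
  have h3 : Real.exp u * Real.exp (-u) = 1 := by rw [← Real.exp_add]; simp
  have h4 : Real.exp u ≤ Real.exp c := Real.exp_le_exp.2 ((le_abs_self u).trans hu)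
  have h5 : 1 ≤ Real.exp c := Real.one_le_exp hc
  have h6 : Real.exp u - 1 ≤ u * Real.exp u := by nlinarith [Real.exp_pos u]
  have h7 : u * Real.exp u ≤ |u| * Real.exp c :=
    mul_le_mul (le_abs_self u) h4 (Real.exp_pos u).le (abs_nonneg u)
  rw [abs_le]
  constructor
  · nlinarith [neg_abs_le u, abs_nonneg u]
  · linarith

/-- The Peano kernel at unit step of the Grünwald approximation of the fractional derivative
at a point shifted by `α / 2`. -/
def grunwaldKernel (α t : ℝ) : ℝ :=
  ∑ n ∈ Finset.range (⌊t⌋₊ + 1), grunwaldWeight α n * ((t - n) ^ 2 / 2) -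
    max (t - α / 2) 0 ^ (2 - α) / Real.Gamma (3 - α)

/-- The bound on the Peano kernel, written with `β = 2 - α`, `p = m + β / 2` and `p + φ = t - α / 2`. -/
lemma abs_gamma_expansion_sub_rpow_le {β φ : ℝ} (h1 : 1 < β) (h2 : β < 2) (m : ℕ)
    (hφ : -1 ≤ φ) (hφ0 : φ ≤ 0) (hp : 0 ≤ m + β / 2 + φ) :
    |Real.Gamma β * risingCoeff β m * (m + β / 2 + β * φ) +
        φ ^ 2 / 2 * β * (Real.Gamma β * risingCoeff β m * ((β - 1) / (β - 1 + m))) -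
        (m + β / 2 + φ) ^ β| ≤
      (7 * Real.exp 2 + 1) * (m + β / 2) ^ (β - 2) := by
  have hβ : 0 < β := by linarith
  have hφ2 : φ ^ 2 ≤ 1 := (sq_le_one_iff_abs_le_one φ).2 (abs_le.2 ⟨hφ, by linarith⟩)
  have hm : (0 : ℝ) ≤ m := m.cast_nonneg
  set p : ℝ := m + β / 2 with hpdef
  have hp0 : 0 < p := by positivity
  have hpm : p ≤ m + 1 := by simp only [hpdef]; linarith
  set u := logGammaRatio β m
  have hu := abs_logGammaRatio_le h1 h2 m
  have hu2 : |u| ≤ 2 := hu.trans (by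
    rw [div_le_iff₀ (by positivity)]
    nlinarith)
  have hexp : Real.exp u ≤ Real.exp 2 := Real.exp_le_exp.2 ((le_abs_self u).trans hu2)
  rw [risingCoeff_eq_exp_logGammaRatio hβ]
  have hpow1 : p ^ (β - 1) = p ^ (β - 2) * p := by
    rw [← Real.rpow_add_one hp0.ne']; ring_nf
  have hpow2 : p ^ β = p ^ (β - 2) * p ^ 2 := by
    rw [← Real.rpow_natCast p 2, ← Real.rpow_add hp0]; norm_num
  have hw : 0 < p ^ (β - 2) := by positivity
  have hq : -1 ≤ φ / p := by rw [le_div_iff₀ hp0]; linarith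
  have hpφ : (p + φ) ^ β = p ^ β * (1 + φ / p) ^ β := by
    rw [← Real.mul_rpow hp0.le (by linarith)]
    congr 1
    field_simp
  have hb := abs_one_add_rpow_sub_le hq h1.le h2.le
  -- With `p^(β-2)` factored out, three bounded pieces remain: the Gamma ratio error, the Bernoulli
  -- error and the term quadratic in `φ`.
  have key : p ^ (β - 1) * Real.exp u * (p + β * φ) +
        φ ^ 2 / 2 * β * (p ^ (β - 1) * Real.exp u * ((β - 1) / (β - 1 + m))) - (p + φ) ^ β =
      p ^ (β - 2) * (p * (p + β * φ) * (Real.exp u - 1) +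
        p ^ 2 * (1 + β * (φ / p) - (1 + φ / p) ^ β) +
        φ ^ 2 / 2 * β * (p * Real.exp u * ((β - 1) / (β - 1 + m)))) := by
    rw [hpφ, hpow1, hpow2]
    field_simp
    ring
  rw [key, abs_mul, abs_of_pos hw, mul_comm]
  refine mul_le_mul_of_nonneg_right ?_ hw.le
  have hE := Real.exp_pos 2
  have t1 : |p * (p + β * φ) * (Real.exp u - 1)| ≤ 6 * Real.exp 2 := by
    rw [abs_mul, abs_mul, abs_of_pos hp0]
    have ha : |p + β * φ| ≤ 3 * (m + 1) := by
      have hlo : -2 ≤ β * φ := by nlinarith only [hφ, h2, hβ]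
      have hhi : β * φ ≤ 0 := mul_nonpos_of_nonneg_of_nonpos hβ.le hφ0
      rw [abs_le]; constructor <;> linarith
    have he : |Real.exp u - 1| ≤ 2 / ((m : ℝ) + 1) ^ 2 * Real.exp 2 :=
      (abs_exp_sub_one_le_of_abs_le hu2).trans (by gcongr)
    calc _ ≤ ((m : ℝ) + 1) * (3 * (m + 1)) * (2 / ((m : ℝ) + 1) ^ 2 * Real.exp 2) := by gcongr
      _ = 6 * Real.exp 2 := by field_simp; norm_num
  have t2 : |p ^ 2 * (1 + β * (φ / p) - (1 + φ / p) ^ β)| ≤ 1 := by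
    rw [abs_mul, abs_of_pos (by positivity : 0 < p ^ 2)]
    calc _ ≤ p ^ 2 * (φ / p) ^ 2 := by gcongr
      _ = φ ^ 2 := by field_simp
      _ ≤ 1 := hφ2
  have t3 : |φ ^ 2 / 2 * β * (p * Real.exp u * ((β - 1) / (β - 1 + m)))| ≤ Real.exp 2 := by
    have hβ1 : 0 < β - 1 := by linarith
    rw [abs_of_nonneg (by positivity)]
    have hfrac : (β - 1) / (β - 1 + m) ≤ 1 / ((m : ℝ) + 1) := by
      rw [div_le_div_iff₀ (by positivity) (by positivity)]
      nlinarith only [mul_nonneg hm (by linarith : 0 ≤ 2 - β)]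
    have hA : p * Real.exp u * ((β - 1) / (β - 1 + m)) ≤ Real.exp 2 := by
      calc _ ≤ ((m : ℝ) + 1) * Real.exp 2 * (1 / ((m : ℝ) + 1)) :=
            mul_le_mul (mul_le_mul hpm hexp (Real.exp_pos u).le (by positivity)) hfrac
              (by positivity) (by positivity)
        _ = Real.exp 2 := by field_simp
    have hB : φ ^ 2 / 2 * β ≤ 1 := by
      linarith only [mul_le_mul hφ2 h2.le hβ.le zero_le_one]
    calc _ ≤ 1 * Real.exp 2 := mul_le_mul hB hA (by positivity) zero_le_one
      _ = Real.exp 2 := one_mul _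
  refine (abs_add_three _ _ _).trans ?_
  linarith

lemma grunwaldKernel_zero {α : ℝ} (hα0 : 0 < α) (hα1 : α < 1) : grunwaldKernel α 0 = 0 := by
  rw [grunwaldKernel, max_eq_right (by linarith), Real.zero_rpow (by linarith)]
  simp

lemma grunwaldKernel_of_lt {α t : ℝ} (hα1 : α < 1) (ht : 0 < t) (htα : t < α / 2) :
    grunwaldKernel α t = t ^ 2 / 2 := by
  have hfl : ⌊t⌋₊ = 0 := Nat.floor_eq_zero.2 (by linarith)
  rw [grunwaldKernel, hfl, max_eq_right (by linarith), Real.zero_rpow (by linarith)]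
  simp [grunwaldWeight]

/-- The coefficients with parameters `3 - α` and `1 - α` both reduce to the one with `2 - α` by
`mul_risingCoeff_add_one`. -/
lemma Gamma_mul_grunwaldKernel {α t : ℝ} (hα1 : α < 1) (htα : α / 2 ≤ t) :
    Real.Gamma (3 - α) * grunwaldKernel α t =
      Real.Gamma (2 - α) * risingCoeff (2 - α) ⌊t⌋₊ *
          (⌊t⌋₊ + (2 - α) / 2 + (2 - α) * (t - ⌊t⌋₊ - 1)) +
        (t - ⌊t⌋₊ - 1) ^ 2 / 2 * (2 - α) * (Real.Gamma (2 - α) * risingCoeff (2 - α) ⌊t⌋₊ *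
          ((2 - α - 1) / (2 - α - 1 + ⌊t⌋₊))) -
        (⌊t⌋₊ + (2 - α) / 2 + (t - ⌊t⌋₊ - 1)) ^ (2 - α) := by
  set m := ⌊t⌋₊
  have hm : (0 : ℝ) ≤ m := m.cast_nonneg
  have hsum := sum_grunwaldWeight_mul_sq α m (t - m)
  rw [add_sub_cancel] at hsum
  have h3 := mul_risingCoeff_add_one (2 - α) m
  have h2 := mul_risingCoeff_add_one (1 - α) m
  rw [show 2 - α + 1 = 3 - α by ring] at h3
  rw [show 1 - α + 1 = 2 - α by ring] at h2
  have h2' : risingCoeff (1 - α) m = risingCoeff (2 - α) m * ((1 - α) / (1 - α + m)) := by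
    have : 1 - α + m ≠ 0 := by linarith
    field_simp
    linear_combination -h2
  have hΓ : Real.Gamma (3 - α) = (2 - α) * Real.Gamma (2 - α) := by
    rw [← Real.Gamma_add_one (by linarith)]; ring_nf
  have hΓ0 : Real.Gamma (3 - α) ≠ 0 := (Real.Gamma_pos_of_pos (by linarith)).ne'
  rw [grunwaldKernel, hsum, max_eq_left (by linarith), mul_sub, mul_div_cancel₀ _ hΓ0, h2', hΓ,
    show (m : ℝ) + (2 - α) / 2 + (t - m - 1) = t - α / 2 by ring,
    show 2 - α - 1 = 1 - α by ring]
  linear_combination Real.Gamma (2 - α) * h3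

lemma exists_abs_grunwaldKernel_le {α : ℝ} (hα0 : 0 < α) (hα1 : α < 1) :
    ∃ C : ℝ, 0 ≤ C ∧ ∀ t : ℝ, 0 ≤ t → |grunwaldKernel α t| ≤ C * t ^ (-α) := by
  have hΓ := Real.Gamma_pos_of_pos (show 0 < 3 - α by linarith)
  have hE := Real.exp_pos 2
  refine ⟨1 + 2 * (7 * Real.exp 2 + 1) / Real.Gamma (3 - α), by positivity, fun t ht => ?_⟩
  -- At `t = 0` the bound is `0`, since `0 ^ (-α) = 0` in Lean, so the kernel has to vanish there.
  rcases ht.eq_or_lt with rfl | ht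
  · rw [grunwaldKernel_zero hα0 hα1, Real.zero_rpow (by linarith)]
    simp
  have htp : 0 < t ^ (-α) := by positivity
  rcases lt_or_ge t (α / 2) with htα | htα
  · rw [grunwaldKernel_of_lt hα1 ht htα, abs_of_nonneg (by positivity)]
    have h1 := Real.one_le_rpow_of_pos_of_le_one_of_nonpos ht (by linarith : t ≤ 1)
      (by linarith : -α ≤ 0)
    have : 0 ≤ 2 * (7 * Real.exp 2 + 1) / Real.Gamma (3 - α) * t ^ (-α) := by positivity
    nlinarith
  · have hfl := Nat.floor_le ht.le
    have hfl' := Nat.lt_floor_add_one t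
    have hm : (0 : ℝ) ≤ (⌊t⌋₊ : ℝ) := Nat.cast_nonneg _
    have h := abs_gamma_expansion_sub_rpow_le (β := 2 - α) (φ := t - ⌊t⌋₊ - 1) (by linarith)
      (by linarith) ⌊t⌋₊ (by linarith) (by linarith) (by linarith)
    rw [← Gamma_mul_grunwaldKernel hα1 htα, abs_mul, abs_of_pos hΓ,
      show 2 - α - 2 = -α by ring] at h
    -- `p ≥ t / 2` because `t < ⌊t⌋ + 1` and `α < 1`.
    have hp : ((⌊t⌋₊ : ℝ) + (2 - α) / 2) ^ (-α) ≤ 2 * t ^ (-α) := by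
      calc _ ≤ (t / 2) ^ (-α) :=
            Real.rpow_le_rpow_of_nonpos (by positivity) (by linarith) (by linarith)
        _ = t ^ (-α) * 2 ^ α := by
            rw [Real.div_rpow ht.le zero_le_two, Real.rpow_neg zero_le_two α, div_inv_eq_mul]
        _ ≤ t ^ (-α) * 2 ^ (1 : ℝ) := by
            gcongr
            norm_num
        _ = _ := by rw [Real.rpow_one, mul_comm]
    have h' : |grunwaldKernel α t| ≤
        (7 * Real.exp 2 + 1) * (2 * t ^ (-α)) / Real.Gamma (3 - α) := by
      rw [le_div_iff₀ hΓ, mul_comm]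
      exact h.trans (by gcongr)
    calc _ ≤ _ := h'
      _ = 2 * (7 * Real.exp 2 + 1) / Real.Gamma (3 - α) * t ^ (-α) := by ring
      _ ≤ _ := by nlinarith

/-! ### Integral representations and the error formula -/

/-- Integration by parts: the boundary term vanishes at `b` by `hb` and at `x` because `c + 1 > 0`.
-/
lemma integral_mul_sub_rpow {f f' : ℝ → ℝ} {b x c : ℝ} (hbx : b ≤ x) (hc : -1 < c)
    (hf : ContinuousOn f (Icc b x)) (hf' : ContinuousOn f' (Icc b x))
    (hd : ∀ s ∈ Ioo b x, HasDerivAt f (f' s) s) (hb : f b = 0) :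
    ∫ s in b..x, f s * (x - s) ^ c = ∫ s in b..x, f' s * ((x - s) ^ (c + 1) / (c + 1)) := by
  have hc1 : 0 < c + 1 := by linarith
  have hv : Continuous fun s => -((x - s) ^ (c + 1) / (c + 1)) :=
    (((continuous_const.sub continuous_id).rpow_const fun _ => Or.inr hc1.le).div_const _).neg
  have hint : IntervalIntegrable (fun s => (x - s) ^ c) MeasureTheory.volume b x := by
    have := (intervalIntegral.intervalIntegrable_rpow' (a := x - b) (b := 0) hc).comp_sub_left x
    simpa using this
  rw [← uIcc_of_le hbx] at hf hf'
  rw [intervalIntegral.integral_mul_deriv_eq_deriv_mul_of_hasDerivAt (u := f) (u' := f')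
    (v := fun s => -((x - s) ^ (c + 1) / (c + 1))) hf hv.continuousOn
    (by simpa [hbx] using hd) ?_ hf'.intervalIntegrable hint]
  · simp [hb, Real.zero_rpow hc1.ne']
  · intro s hs
    rw [min_eq_left hbx, max_eq_right hbx] at hs
    have h1 : HasDerivAt (fun s => x - s) (-1) s := by
      simpa using (hasDerivAt_id s).const_sub x
    have h2 := ((h1.rpow_const (p := c + 1) (Or.inl (sub_pos.2 hs.2).ne')).div_const (c + 1)).neg
    convert! h2 using 1
    rw [add_sub_cancel_right]
    field_simp

lemma hasDerivAt_iteratedDerivWithin_Icc {y : ℝ → ℝ} {b X : ℝ} {n : WithTop ℕ∞} {k : ℕ}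
    (hy : ContDiffOn ℝ n y (Icc b X)) (hk : (k : WithTop ℕ∞) < n) {s : ℝ} (hs : s ∈ Ioo b X) :
    HasDerivAt (iteratedDerivWithin k y (Icc b X)) (iteratedDerivWithin (k + 1) y (Icc b X) s)
      s := by
  have hbX : b < X := hs.1.trans hs.2
  have h := hy.differentiableOn_iteratedDerivWithin hk (uniqueDiffOn_Icc hbX) s ⟨hs.1.le, hs.2.le⟩
  rw [iteratedDerivWithin_succ]
  exact h.hasDerivWithinAt.hasDerivAt (Icc_mem_nhds hs.1 hs.2)

section PeanoRepresentation

variable {y : ℝ → ℝ} {b X : ℝ}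

/-- Two integrations by parts. The case `c = 0` represents `y`, and `c = -α` its Caputo derivative.
-/
lemma integral_iteratedDerivWithin_one_mul_sub_rpow (hbX : b < X)
    (hy : ContDiffOn ℝ 3 y (Icc b X))
    (hy1 : iteratedDerivWithin 1 y (Icc b X) b = 0)
    (hy2 : iteratedDerivWithin 2 y (Icc b X) b = 0) {x c : ℝ} (hx : x ∈ Icc b X) (hc : -1 < c) :
    ∫ s in b..x, iteratedDerivWithin 1 y (Icc b X) s * (x - s) ^ c =
      ∫ s in b..x, iteratedDerivWithin 3 y (Icc b X) s *
        ((x - s) ^ (c + 2) / ((c + 1) * (c + 2))) := by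
  have hsub : Icc b x ⊆ Icc b X := Icc_subset_Icc_right hx.2
  have hcont : ∀ k : ℕ, k ≤ 3 → ContinuousOn (iteratedDerivWithin k y (Icc b X)) (Icc b x) :=
    fun k hk => (hy.continuousOn_iteratedDerivWithin (by exact_mod_cast hk)
      (uniqueDiffOn_Icc hbX)).mono hsub
  have hder : ∀ k : ℕ, k < 3 → ∀ s ∈ Ioo b x, HasDerivAt (iteratedDerivWithin k y (Icc b X))
      (iteratedDerivWithin (k + 1) y (Icc b X) s) s := fun k hk s hs =>
    hasDerivAt_iteratedDerivWithin_Icc hy (by exact_mod_cast hk) ⟨hs.1, hs.2.trans_le hx.2⟩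
  rw [integral_mul_sub_rpow hx.1 hc (hcont 1 (by norm_num)) (hcont 2 (by norm_num))
    (hder 1 (by norm_num)) hy1]
  have h := integral_mul_sub_rpow hx.1 (show -1 < c + 1 by linarith) (hcont 2 (by norm_num))
    (hcont 3 le_rfl) (hder 2 (by norm_num)) hy2
  simp only [← mul_div_assoc, intervalIntegral.integral_div] at h ⊢
  rw [h, show c + 1 + 1 = c + 2 by ring, div_div, mul_comm (c + 2)]

lemma eq_integral_iteratedDerivWithin_three (hbX : b < X) (hy : ContDiffOn ℝ 3 y (Icc b X))
    (hy0 : y b = 0) (hy1 : iteratedDerivWithin 1 y (Icc b X) b = 0)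
    (hy2 : iteratedDerivWithin 2 y (Icc b X) b = 0) {x : ℝ} (hx : x ∈ Icc b X) :
    y x = ∫ s in b..x, iteratedDerivWithin 3 y (Icc b X) s * ((x - s) ^ 2 / 2) := by
  have hsub : Icc b x ⊆ Icc b X := Icc_subset_Icc_right hx.2
  have hftc : ∫ s in b..x, iteratedDerivWithin 1 y (Icc b X) s = y x - y b := by
    refine intervalIntegral.integral_eq_sub_of_hasDerivAt_of_le hx.1 (hy.continuousOn.mono hsub)
      (fun s hs => ?_) ?_
    · have := hasDerivAt_iteratedDerivWithin_Icc (k := 0) hy (by norm_num)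
        ⟨hs.1, hs.2.trans_le hx.2⟩
      simpa only [iteratedDerivWithin_zero] using this
    · refine ContinuousOn.intervalIntegrable ?_
      rw [uIcc_of_le hx.1]
      exact (hy.continuousOn_iteratedDerivWithin (m := 1) (by norm_num)
        (uniqueDiffOn_Icc hbX)).mono hsub
  have h := integral_iteratedDerivWithin_one_mul_sub_rpow hbX hy hy1 hy2 hx
    (show (-1 : ℝ) < 0 by norm_num)
  simp only [Real.rpow_zero, mul_one, hftc, hy0, sub_zero, zero_add, one_mul, Real.rpow_two] at h
  exact h

lemma caputoDeriv_eq_integral_iteratedDerivWithin_three (hbX : b < X)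
    (hy : ContDiffOn ℝ 3 y (Icc b X)) (hy1 : iteratedDerivWithin 1 y (Icc b X) b = 0)
    (hy2 : iteratedDerivWithin 2 y (Icc b X) b = 0) {α x : ℝ} (hα1 : α < 1)
    (hx : x ∈ Icc b X) :
    caputoDeriv α b y x = ∫ s in b..x, iteratedDerivWithin 3 y (Icc b X) s *
      ((x - s) ^ (2 - α) / Real.Gamma (3 - α)) := by
  have hcongr : ∫ s in b..x, deriv y s / (x - s) ^ α =
      ∫ s in b..x, iteratedDerivWithin 1 y (Icc b X) s * (x - s) ^ (-α) := by
    refine intervalIntegral.integral_congr_Ioo_of_le hx.1 fun s hs => ?_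
    have h := hasDerivAt_iteratedDerivWithin_Icc (k := 0) hy (by norm_num)
      ⟨hs.1, hs.2.trans_le hx.2⟩
    rw [iteratedDerivWithin_zero] at h
    simp only [zero_add] at h
    rw [h.deriv, Real.rpow_neg (sub_pos.2 hs.2).le, div_eq_mul_inv]
  have hΓ : Real.Gamma (3 - α) = (2 - α) * ((1 - α) * Real.Gamma (1 - α)) := by
    rw [← Real.Gamma_add_one (by linarith), show 1 - α + 1 = 2 - α by ring,
      ← Real.Gamma_add_one (by linarith)]
    ring_nf
  have hΓ0 := (Real.Gamma_pos_of_pos (show 0 < 1 - α by linarith)).ne'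
  have h1 : 1 - α ≠ 0 := by linarith
  have h2 : 2 - α ≠ 0 := by linarith
  rw [caputoDeriv, hcongr, integral_iteratedDerivWithin_one_mul_sub_rpow hbX hy hy1 hy2 hx
    (by linarith), hΓ, neg_add_eq_sub, neg_add_eq_sub]
  simp only [← mul_div_assoc, intervalIntegral.integral_div]
  field_simp

end PeanoRepresentation

/-- Truncation by the positive part puts integrals with different upper limits on the common
interval `[b, x]`, so that they can be added. -/
lemma integral_mul_comp_sub_eq_integral_max {g φ : ℝ → ℝ} {b a x : ℝ} (hba : b ≤ a) (hax : a ≤ x)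
    (hg : ContinuousOn g (Icc b x)) (hφ : Continuous φ) (hφ0 : φ 0 = 0) :
    ∫ s in b..a, g s * φ (a - s) = ∫ s in b..x, g s * φ (max (a - s) 0) := by
  have hint : ∀ u v, b ≤ u → u ≤ v → v ≤ x →
      IntervalIntegrable (fun s => g s * φ (max (a - s) 0)) MeasureTheory.volume u v := by
    intro u v hu huv hv
    refine ContinuousOn.intervalIntegrable ?_
    rw [uIcc_of_le huv]
    exact (hg.mono (Icc_subset_Icc hu hv)).mul (by fun_prop)
  rw [← intervalIntegral.integral_add_adjacent_intervals (hint b a le_rfl hba hax)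
    (hint a x hba hax le_rfl)]
  have h2 : ∫ s in a..x, g s * φ (max (a - s) 0) = 0 := by
    refine intervalIntegral.integral_zero_ae (Filter.Eventually.of_forall fun s hs => ?_)
    rw [uIoc_of_le hax] at hs
    rw [max_eq_right (by linarith [hs.1]), hφ0, mul_zero]
  rw [h2, add_zero]
  refine intervalIntegral.integral_congr fun s hs => ?_
  rw [uIcc_of_le hba] at hs
  rw [max_eq_left (by linarith [hs.2])]

/-- Homogeneity in `h`. The terms with `n > z / h` vanish by truncation, so one `N` serves every `z
= x - s`. -/
lemma grunwaldKernel_scaled {α h z : ℝ} (hh : 0 < h) (hz : 0 ≤ z) {N : ℕ}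
    (hN : ⌊z / h⌋₊ ≤ N) :
    h ^ (-α) * ∑ n ∈ Finset.range (N + 1), grunwaldWeight α n * (max (z - n * h) 0 ^ 2 / 2) -
        max (z - α * h / 2) 0 ^ (2 - α) / Real.Gamma (3 - α) =
      h ^ (2 - α) * grunwaldKernel α (z / h) := by
  have hsum : ∑ n ∈ Finset.range (N + 1), grunwaldWeight α n * (max (z - n * h) 0 ^ 2 / 2) =
      h ^ 2 * ∑ n ∈ Finset.range (⌊z / h⌋₊ + 1), grunwaldWeight α n * ((z / h - n) ^ 2 / 2) := by
    rw [← Finset.sum_subset (Finset.range_mono (Nat.add_le_add_right hN 1)), Finset.mul_sum]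
    · refine Finset.sum_congr rfl fun n hn => ?_
      have hn' : (n : ℝ) ≤ z / h :=
        (Nat.le_floor_iff (by positivity)).1 (Nat.lt_succ_iff.1 (Finset.mem_range.1 hn))
      rw [le_div_iff₀ hh] at hn'
      rw [max_eq_left (by linarith)]
      field_simp
    · intro n _ hn
      have hn' : z / h < n :=
        (Nat.floor_lt (by positivity)).1 (Nat.lt_of_succ_le (not_lt.1 (mt Finset.mem_range.2 hn)))
      rw [div_lt_iff₀ hh] at hn'
      rw [max_eq_right (by linarith)]
      simp
  have hmax : max (z - α * h / 2) 0 = h * max (z / h - α / 2) 0 := by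
    rw [mul_max_of_nonneg _ _ hh.le, mul_zero]
    congr 1
    field_simp
  have hpow : h ^ (2 - α) = h ^ (-α) * h ^ 2 := by
    rw [← Real.rpow_natCast h 2, ← Real.rpow_add hh, Nat.cast_ofNat, neg_add_eq_sub]
  rw [hsum, hmax, Real.mul_rpow hh.le (le_max_right _ _), grunwaldKernel, hpow]
  ring

lemma grunwald_sub_caputoDeriv_eq_integral {α b X x h : ℝ} {y : ℝ → ℝ} (hα0 : 0 < α)
    (hα1 : α < 1) (hbX : b < X) (hy : ContDiffOn ℝ 3 y (Icc b X)) (hy0 : y b = 0)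
    (hy1 : iteratedDerivWithin 1 y (Icc b X) b = 0)
    (hy2 : iteratedDerivWithin 2 y (Icc b X) b = 0) (hx : x ∈ Icc b X) (hh : 0 < h)
    (hxh : b ≤ x - α * h / 2) :
    h ^ (-α) * grunwaldDiff α b h y x - caputoDeriv α b y (x - α * h / 2) =
      ∫ s in b..x, iteratedDerivWithin 3 y (Icc b X) s *
        (h ^ (2 - α) * grunwaldKernel α ((x - s) / h)) := by
  set g := iteratedDerivWithin 3 y (Icc b X)
  set N := ⌊(x - b) / h⌋₊
  have hαh : 0 < α * h := mul_pos hα0 hh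
  have hg : ContinuousOn g (Icc b x) := (hy.continuousOn_iteratedDerivWithin (m := 3) le_rfl
    (uniqueDiffOn_Icc hbX)).mono (Icc_subset_Icc_right hx.2)
  have hint : ∀ ψ : ℝ → ℝ, Continuous ψ →
      IntervalIntegrable (fun s => g s * ψ s) MeasureTheory.volume b x := fun ψ hψ => by
    refine ContinuousOn.intervalIntegrable ?_
    rw [uIcc_of_le hx.1]
    exact hg.mul hψ.continuousOn
  have hrpow : Continuous fun t : ℝ => t ^ (2 - α) :=
    Real.continuous_rpow_const (by linarith)
  have hcap : caputoDeriv α b y (x - α * h / 2) =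
      ∫ s in b..x, g s * (max (x - α * h / 2 - s) 0 ^ (2 - α) / Real.Gamma (3 - α)) := by
    rw [caputoDeriv_eq_integral_iteratedDerivWithin_three hbX hy hy1 hy2 hα1
      ⟨hxh, by linarith [hx.2]⟩]
    exact integral_mul_comp_sub_eq_integral_max (φ := fun t => t ^ (2 - α) / Real.Gamma (3 - α))
      hxh (by linarith) hg (hrpow.div_const _) (by simp [Real.zero_rpow (by linarith : 2 - α ≠ 0)])
  have hval : ∀ n ∈ Finset.range (N + 1), grunwaldWeight α n * y (x - n * h) =
      ∫ s in b..x, g s * (grunwaldWeight α n * (max (x - n * h - s) 0 ^ 2 / 2)) := by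
    intro n hn
    have hn' : (n : ℝ) ≤ (x - b) / h := (Nat.le_floor_iff (div_nonneg (by linarith [hx.1]) hh.le)).1
      (Nat.lt_succ_iff.1 (Finset.mem_range.1 hn))
    rw [le_div_iff₀ hh] at hn'
    have hnh : 0 ≤ n * h := by positivity
    rw [eq_integral_iteratedDerivWithin_three hbX hy hy0 hy1 hy2
      (x := x - n * h) ⟨by linarith, by linarith [hx.2]⟩,
      integral_mul_comp_sub_eq_integral_max (φ := fun t => t ^ 2 / 2) (by linarith)
        (by linarith) hg (by fun_prop) (by simp), ← intervalIntegral.integral_const_mul]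
    simp only [mul_left_comm]
  rw [grunwaldDiff, Finset.sum_congr rfl hval, ← intervalIntegral.integral_finsetSum
    (fun n _ => hint _ (by fun_prop)), ← intervalIntegral.integral_const_mul, hcap,
    ← intervalIntegral.integral_sub]
  · refine intervalIntegral.integral_congr fun s hs => ?_
    rw [uIcc_of_le hx.1] at hs
    have hfl : ⌊(x - s) / h⌋₊ ≤ N := Nat.floor_le_floor (by gcongr; exact hs.1)
    rw [← grunwaldKernel_scaled hh (sub_nonneg.2 hs.2) hfl, ← Finset.mul_sum]
    simp only [sub_right_comm x s]
    ring
  · simp only [← Finset.mul_sum, mul_left_comm _ (g _)]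
    exact hint _ (by fun_prop)
  · exact hint _ ((hrpow.comp (by fun_prop)).div_const _)

lemma integral_sub_rpow {b x c : ℝ} (hc : -1 < c) :
    ∫ s in b..x, (x - s) ^ c = (x - b) ^ (c + 1) / (c + 1) := by
  rw [intervalIntegral.integral_comp_sub_left (fun t => t ^ c), sub_self,
    integral_rpow (Or.inl hc), Real.zero_rpow (by linarith), sub_zero]

end

/-! ### The uniform error estimate -/

theorem corollary2 (α b X : ℝ) (hα0 : 0 < α) (hα1 : α < 1) (hbX : b < X) (y : ℝ → ℝ)
    (hy : ContDiffOn ℝ 4 y (Icc b X))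
    (hy0 : y b = 0)
    (hy1 : iteratedDerivWithin 1 y (Icc b X) b = 0)
    (hy2 : iteratedDerivWithin 2 y (Icc b X) b = 0) :
    ∃ C : ℝ, ∀ x ∈ Ioc b X, ∀ h : ℝ, 0 < h → b ≤ x - α * h / 2 →
      |h ^ (-α) * grunwaldDiff α b h y x - caputoDeriv α b y (x - α * h / 2)| ≤ C * h ^ 2 := by
  have hy3 : ContDiffOn ℝ 3 y (Icc b X) := hy.of_le (by norm_num)
  obtain ⟨M, hM⟩ := isCompact_Icc.exists_bound_of_continuousOn
    (hy3.continuousOn_iteratedDerivWithin (m := 3) le_rfl (uniqueDiffOn_Icc hbX))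
  have hM0 : 0 ≤ M := (norm_nonneg _).trans (hM b (left_mem_Icc.2 hbX.le))
  obtain ⟨K, hK0, hK⟩ := exists_abs_grunwaldKernel_le hα0 hα1
  -- `M` bounds `y'''`, `K` is the kernel constant, and the last factor is `∫_b^X (X - s)^(-α) ds`.
  refine ⟨M * K * ((X - b) ^ (-α + 1) / (-α + 1)), fun x hx h hh hxh => ?_⟩
  have hα1' : 0 < -α + 1 := by linarith
  rw [grunwald_sub_caputoDeriv_eq_integral hα0 hα1 hbX hy3 hy0 hy1 hy2 (Ioc_subset_Icc_self hx) hh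
    hxh]
  have hpow : ∀ s ≤ x, h ^ (2 - α) * ((x - s) / h) ^ (-α) = h ^ 2 * (x - s) ^ (-α) := by
    intro s hs
    have h1 : h ^ (2 - α) = h ^ (-α) * h ^ 2 := by
      rw [← Real.rpow_natCast h 2, ← Real.rpow_add hh, Nat.cast_ofNat, neg_add_eq_sub]
    have : 0 < h ^ (-α) := by positivity
    rw [Real.div_rpow (sub_nonneg.2 hs) hh.le, h1]
    field_simp
  have hint : IntervalIntegrable (fun s => M * K * h ^ 2 * (x - s) ^ (-α))
      MeasureTheory.volume b x := by
    have := (intervalIntegral.intervalIntegrable_rpow' (a := x - b) (b := 0)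
      (show -1 < -α by linarith)).comp_sub_left x
    simpa using this.const_mul (M * K * h ^ 2)
  have hle := intervalIntegral.norm_integral_le_of_norm_le (μ := MeasureTheory.volume)
    (f := fun s => iteratedDerivWithin 3 y (Icc b X) s *
      (h ^ (2 - α) * grunwaldKernel α ((x - s) / h))) hx.1.le
    (Filter.Eventually.of_forall fun s hs => ?_) hint
  · rw [intervalIntegral.integral_const_mul, integral_sub_rpow (by linarith)] at hle
    refine hle.trans ?_
    rw [mul_right_comm _ (_ / _)]
    have := hx.1
    gcongr
    exact hx.2
  · rw [norm_mul, norm_mul, Real.norm_of_nonneg (by positivity : 0 ≤ h ^ (2 - α)),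
      Real.norm_eq_abs (grunwaldKernel _ _)]
    calc _ ≤ M * (h ^ (2 - α) * (K * ((x - s) / h) ^ (-α))) := by
          gcongr
          · exact hM s ⟨hs.1.le, hs.2.trans hx.2⟩
          · exact hK _ (div_nonneg (sub_nonneg.2 hs.2) hh.le)
      _ = M * K * (h ^ (2 - α) * ((x - s) / h) ^ (-α)) := by ring
      _ = _ := by rw [hpow s hs.2]; ring
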